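/- Let $X$ be a second countable locally compact Hausdorff space and let $G$ be a groupoid with unit space $X$, with range and source maps $r,s:G\to X$, product $\gamma\gamma'$ defined exactly when $s(\gamma)=r(\gamma')$, and identity elements $i_x$ ($x\in X$). Suppose that $G$ carries a second countable, locally compact, locally Hausdorff topology for which $G$ is a continuous groupoid, that is, $r$, $s$, $x\mapsto i_x$, inversion $G\to G$, and multiplication $\{(\gamma,\gamma')\in G\times G: s(\gamma)=r(\gamma')\}\to G$ are all continuous (so that $x\mapsto i_x$ is a homeomorphism of $X$ onto the set of units, by which $X$ is regarded as a subset of $G$). The map $r$ is not required to be open. (Here locally compact means that every point has a neighborhood base of compact sets, and locally Hausdorff means that every point has an open neighborhood that is Hausdorff.) For $x\in X$ let $[x]=\{s(\gamma):\gamma\in G,\ r(\gamma)=x\}$ be the orbit of $x$, and for $y\in X$ and $U\subseteq G$ put $[y]U=\{s(\gamma):\gamma\in U,\ r(\gamma)=y\}$. Call a Borel set $Y\subseteq X$ a complete lacunary section if $Y\cap[x]\neq\emptyset$ for every $x\in X$ and there is an open set $U\subseteq G$ with $X\subseteq U$ such that $([y]U)\cap Y=\{y\}$ for every $y\in Y$.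 Then $X$ contains a complete lacunary section. Moreover, for every complete lacunary section $Y\subseteq X$ and every $x\in X$, the set $Y\cap[x]$ is countable. -/

import Mathlib

/-- An algebraic groupoid `G` on a set `X` (a small category with inverses, described by its set `G`
of arrows): range and source maps `r, s : G → X`, a product `mul a b` defined exactly for the pairs
with `s a = r b`, an identity element `unit x` at each `x : X`, and inverses. -/
structure GroupoidOn (G : Type*) (X : Type*) where
  /-- the range map -/
  r : G → X
  /-- the source map -/
  s : G → X
  /-- the product, defined on composable pairs -/
  mul : (a b : G) → s a = r b → G
  /-- the identity at a point of `X` -/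
  unit : X → G
  /-- the inverse -/
  inv : G → G
  r_mul : ∀ (a b : G) (h : s a = r b), r (mul a b h) = r a
  s_mul : ∀ (a b : G) (h : s a = r b), s (mul a b h) = s b
  mul_assoc : ∀ (a b c : G) (hab : s a = r b) (hbc : s b = r c),
    mul (mul a b hab) c ((s_mul a b hab).trans hbc) =
      mul a (mul b c hbc) (hab.trans (r_mul b c hbc).symm)
  r_unit : ∀ x : X, r (unit x) = x
  s_unit : ∀ x : X, s (unit x) = x
  mul_unit : ∀ a : G, mul a (unit (s a)) (r_unit (s a)).symm = a
  unit_mul : ∀ a : G, mul (unit (r a)) a (s_unit (r a)) = a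
  r_inv : ∀ a : G, r (inv a) = s a
  s_inv : ∀ a : G, s (inv a) = r a
  mul_inv : ∀ a : G, mul a (inv a) (r_inv a).symm = unit (r a)
  inv_mul : ∀ a : G, mul (inv a) a (s_inv a) = unit (s a)

namespace GroupoidOn

variable {G X : Type*}

/-- All structure maps of the groupoid are continuous; the product is considered on the space
`{(a, b) | s a = r b}` of composable pairs with the subspace topology of `G × G`. The range map is
not required to be open. -/
structure IsContinuous [TopologicalSpace G] [TopologicalSpace X] (𝒢 : GroupoidOn G X) : Prop where
  continuous_r : Continuous 𝒢.r
  continuous_s : Continuous 𝒢.s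
  continuous_unit : Continuous 𝒢.unit
  continuous_inv : Continuous 𝒢.inv
  continuous_mul :
    Continuous fun p : {p : G × G // 𝒢.s p.1 = 𝒢.r p.2} => 𝒢.mul p.1.1 p.1.2 p.2

/-- In a continuous groupoid the identification of `X` with the set of units of `G` is
topological. -/
theorem IsContinuous.isEmbedding_unit [TopologicalSpace G] [TopologicalSpace X]
    {𝒢 : GroupoidOn G X} (h : 𝒢.IsContinuous) : Topology.IsEmbedding 𝒢.unit :=
  Topology.IsEmbedding.of_leftInverse 𝒢.r_unit h.continuous_r h.continuous_unit

/-- The product `A B`: the set of all products `a b` of composable pairs with `a ∈ A`, `b ∈ B`. -/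
def prod (𝒢 : GroupoidOn G X) (A B : Set G) : Set G :=
  {c | ∃ a ∈ A, ∃ b ∈ B, ∃ h : 𝒢.s a = 𝒢.r b, 𝒢.mul a b h = c}

/-- `[A]B = s(AB)` for `A ⊆ X` and `B ⊆ G`, where `A` is regarded as a set of units of `G`. -/
def bracket (𝒢 : GroupoidOn G X) (A : Set X) (B : Set G) : Set X :=
  𝒢.s '' 𝒢.prod (𝒢.unit '' A) B

/-- The orbit `[x] = s(xG)` of `x`, where `xG = {γ | r γ = x}`. -/
def orbit (𝒢 : GroupoidOn G X) (x : X) : Set X :=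
  𝒢.s '' {γ | 𝒢.r γ = x}

/-- A complete lacunary section: a Borel set `Y ⊆ X` that contains a point of every orbit and for
which there is an open set `U ⊆ G` containing all units with `[y]U ∩ Y = {y}` for all `y ∈ Y`. -/
structure IsCompleteLacunarySection [TopologicalSpace G] [TopologicalSpace X]
    (𝒢 : GroupoidOn G X) (Y : Set X) : Prop where
  measurableSet : @MeasurableSet X (borel X) Y
  meets_orbit : ∀ x : X, (𝒢.orbit x ∩ Y).Nonempty
  lacunary : ∃ U : Set G, IsOpen U ∧ Set.range 𝒢.unit ⊆ U ∧
    ∀ y ∈ Y, 𝒢.bracket {y} U ∩ Y = {y}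

end GroupoidOn

/-- A topological space is locally Hausdorff if every point has an open neighbourhood that is
Hausdorff in the subspace topology. -/
def IsLocallyHausdorff (G : Type*) [TopologicalSpace G] : Prop :=
  ∀ γ : G, ∃ U : Set G, IsOpen U ∧ γ ∈ U ∧ T2Space U

open Set Topology TopologicalSpace

namespace GroupoidOn

variable {G X : Type*} {𝒢 : GroupoidOn G X}

/-! Fix a neighbourhood `L` of the units whose part over each compact set is compact
(`exists_proper_nhds_unit`). Being joined by an arrow of `L` need not be transitive on `X`, but `X`
is a countable union of compact sets `K n` on which it is an equivalence relation
(`exists_countable_isArrowRelCompact`). Its classes in `K n` are compact, so minimizing an injective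
lower semicontinuous real function over each gives a Borel transversal `T n` (`exists_transversal`).
Removing from `T n` the orbits that meet an earlier `K j` and taking the union over `n` gives a
section that is lacunary for `interior L`. Countability is separate: `G` is covered by countably
many sets `A` with `A⁻¹A ⊆ U`, and each `A` leads from `x` to at most one point of `Y`. -/

theorem mem_orbit_self (x : X) : x ∈ 𝒢.orbit x := ⟨𝒢.unit x, 𝒢.r_unit x, 𝒢.s_unit x⟩

theorem mem_orbit_symm {x y : X} (h : y ∈ 𝒢.orbit x) : x ∈ 𝒢.orbit y := by
  obtain ⟨γ, hr, hs⟩ := h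
  exact ⟨𝒢.inv γ, (𝒢.r_inv γ).trans hs, (𝒢.s_inv γ).trans hr⟩

theorem mem_orbit_trans {x y z : X} (hxy : y ∈ 𝒢.orbit x) (hyz : z ∈ 𝒢.orbit y) :
    z ∈ 𝒢.orbit x := by
  obtain ⟨a, har, has⟩ := hxy
  obtain ⟨b, hbr, hbs⟩ := hyz
  have h : 𝒢.s a = 𝒢.r b := has.trans (Eq.symm hbr)
  exact ⟨𝒢.mul a b h, (𝒢.r_mul a b h).trans har, (𝒢.s_mul a b h).trans hbs⟩

/-- Two points are related by `L` if some arrow in `L` joins them. -/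
def ArrowRel (𝒢 : GroupoidOn G X) (L : Set G) (y z : X) : Prop :=
  ∃ γ ∈ L, 𝒢.r γ = y ∧ 𝒢.s γ = z

theorem ArrowRel.mem_orbit {L : Set G} {y z : X} (h : 𝒢.ArrowRel L y z) : z ∈ 𝒢.orbit y := by
  obtain ⟨γ, -, hr, hs⟩ := h
  exact ⟨γ, hr, hs⟩

theorem mem_bracket_singleton {U : Set G} {y z : X} :
    z ∈ 𝒢.bracket {y} U ↔ 𝒢.ArrowRel U y z := by
  constructor
  · rintro ⟨c, ⟨a, ⟨y', rfl, rfl⟩, b, hb, h, rfl⟩, rfl⟩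
    exact ⟨b, hb, by rw [← h, 𝒢.s_unit], (𝒢.s_mul _ _ h).symm⟩
  · rintro ⟨b, hb, rfl, rfl⟩
    exact ⟨_, ⟨_, ⟨_, rfl, rfl⟩, b, hb, 𝒢.s_unit _, rfl⟩, 𝒢.s_mul _ _ _⟩

variable [TopologicalSpace G] [TopologicalSpace X]

/-! ### Small neighbourhoods and countability -/

theorem IsContinuous.exists_nhds_mul (h𝒢 : 𝒢.IsContinuous) {W : Set G} (hW : IsOpen W)
    {a₀ b₀ : G} (h₀ : 𝒢.s a₀ = 𝒢.r b₀) (hm : 𝒢.mul a₀ b₀ h₀ ∈ W) :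
    ∃ A ∈ 𝓝 a₀, ∃ B ∈ 𝓝 b₀, ∀ a ∈ A, ∀ b ∈ B, ∀ h : 𝒢.s a = 𝒢.r b, 𝒢.mul a b h ∈ W := by
  have hn : (fun p : {p : G × G // 𝒢.s p.1 = 𝒢.r p.2} => 𝒢.mul p.1.1 p.1.2 p.2) ⁻¹' W ∈
      𝓝 (⟨(a₀, b₀), h₀⟩ : {p : G × G // 𝒢.s p.1 = 𝒢.r p.2}) :=
    h𝒢.continuous_mul.continuousAt.preimage_mem_nhds (hW.mem_nhds hm)
  obtain ⟨O, hO, hOW⟩ := mem_nhds_subtype _ _ _ |>.1 hn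
  obtain ⟨A, hA, B, hB, hAB⟩ := mem_nhds_prod_iff.1 hO
  exact ⟨A, hA, B, hB, fun a ha b hb h =>
    hOW (show (⟨(a, b), h⟩ : {p : G × G // 𝒢.s p.1 = 𝒢.r p.2}) ∈ _ from hAB ⟨ha, hb⟩)⟩

theorem IsContinuous.exists_nhds_inv_mul (h𝒢 : 𝒢.IsContinuous) {W : Set G} (hW : IsOpen W)
    {γ : G} (hγ : 𝒢.unit (𝒢.s γ) ∈ W) :
    ∃ A ∈ 𝓝 γ, ∀ a ∈ A, ∀ b ∈ A, ∀ h : 𝒢.s (𝒢.inv a) = 𝒢.r b, 𝒢.mul (𝒢.inv a) b h ∈ W := by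
  obtain ⟨A, hA, B, hB, hAB⟩ := h𝒢.exists_nhds_mul hW (𝒢.s_inv γ)
    (show 𝒢.mul (𝒢.inv γ) γ (𝒢.s_inv γ) ∈ W by rwa [𝒢.inv_mul])
  refine ⟨𝒢.inv ⁻¹' A ∩ B,
    Filter.inter_mem (h𝒢.continuous_inv.continuousAt.preimage_mem_nhds hA) hB, ?_⟩
  exact fun a ha b hb h => hAB _ ha.1 _ hb.2 h

theorem IsCompleteLacunarySection.countable_orbit_inter [SecondCountableTopology G]
    (h𝒢 : 𝒢.IsContinuous) {Y : Set X} (hY : 𝒢.IsCompleteLacunarySection Y) (x : X) :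
    (𝒢.orbit x ∩ Y).Countable := by
  obtain ⟨U, hU, hXU, hlac⟩ := hY.lacunary
  choose A hA hAU using fun γ : G =>
    h𝒢.exists_nhds_inv_mul hU (hXU (mem_range_self (𝒢.s γ)))
  obtain ⟨t, ht, htu⟩ := TopologicalSpace.countable_cover_nhds hA
  have hsub : 𝒢.orbit x ∩ Y ⊆ ⋃ γ ∈ t, 𝒢.s '' (A γ ∩ {a | 𝒢.r a = x}) ∩ Y := by
    rintro _ ⟨⟨a, har, rfl⟩, hyY⟩
    obtain ⟨γ, hγ, haγ⟩ := mem_iUnion₂.1 (htu ▸ mem_univ a)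
    exact mem_iUnion₂.2 ⟨γ, hγ, ⟨a, ⟨haγ, har⟩, rfl⟩, hyY⟩
  refine (ht.biUnion fun γ _ => Set.Subsingleton.countable ?_).mono hsub
  rintro _ ⟨⟨a, ⟨ha, har⟩, rfl⟩, haY⟩ _ ⟨⟨b, ⟨hb, hbr⟩, rfl⟩, hbY⟩
  -- `a⁻¹b` lies in `U` and joins two points of `Y`, so lacunarity identifies them.
  have h : 𝒢.s (𝒢.inv a) = 𝒢.r b := (𝒢.s_inv a).trans (Eq.trans har (Eq.symm hbr))
  have hmem : 𝒢.s b ∈ 𝒢.bracket {𝒢.s a} U ∩ Y :=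
    ⟨mem_bracket_singleton.2 ⟨_, hAU γ a ha b hb h,
      (𝒢.r_mul _ _ h).trans (𝒢.r_inv a), 𝒢.s_mul _ _ h⟩, hbY⟩
  rw [hlac _ haY] at hmem
  exact hmem.symm

/-! ### Compact pieces on which `L` induces an equivalence relation -/

/-- There is a neighbourhood of the units which is proper over `X` along the range map. -/
theorem IsContinuous.exists_proper_nhds_unit [LocallyCompactSpace X]
    [SecondCountableTopology X] [T2Space X] [LocallyCompactSpace G] (h𝒢 : 𝒢.IsContinuous) :
    ∃ L : Set G, range 𝒢.unit ⊆ interior L ∧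
      ∀ C : Set X, IsCompact C → IsCompact (L ∩ 𝒢.r ⁻¹' C) := by
  let K₀ : CompactExhaustion X := default
  -- The shift makes `K 0` empty, so the differences `K (n + 1) \ K n` cover `X`.
  let K := K₀.shiftr
  choose M hM hKM using fun n =>
    exists_compact_superset ((K.isCompact (n + 1)).image h𝒢.continuous_unit)
  refine ⟨⋃ n, M n ∩ 𝒢.r ⁻¹' (interior (K n))ᶜ, ?_, ?_⟩
  · rintro _ ⟨x, rfl⟩
    obtain ⟨n, hn⟩ : ∃ n, x ∈ K (n + 1) \ K n := ⟨_, K₀.mem_sdiff_shiftr_find x⟩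
    rw [mem_interior]
    refine ⟨interior (M n) ∩ 𝒢.r ⁻¹' (K n)ᶜ, ?_, isOpen_interior.inter
      ((K.isCompact n).isClosed.isOpen_compl.preimage h𝒢.continuous_r),
      hKM n (mem_image_of_mem _ hn.1), ?_⟩
    · intro γ hγ
      exact mem_iUnion.2 ⟨n, interior_subset hγ.1, fun h => hγ.2 (interior_subset h)⟩
    · simpa [𝒢.r_unit] using hn.2
  · intro C hC
    obtain ⟨m, hm⟩ := K.exists_superset_of_isCompact hC
    have heq : (⋃ n, M n ∩ 𝒢.r ⁻¹' (interior (K n))ᶜ) ∩ 𝒢.r ⁻¹' C =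
        ⋃ n ∈ Finset.range (m + 1), M n ∩ 𝒢.r ⁻¹' ((interior (K n))ᶜ ∩ C) := by
      ext γ
      simp only [mem_inter_iff, mem_iUnion, mem_preimage, Finset.mem_range, mem_compl_iff]
      constructor
      · rintro ⟨⟨n, h1, h2⟩, h3⟩
        refine ⟨n, ?_, h1, h2, h3⟩
        by_contra! hn
        exact h2 (K.subset_interior hn (hm h3))
      · rintro ⟨n, -, h1, h2, h3⟩
        exact ⟨⟨n, h1, h2⟩, h3⟩
    rw [heq]
    exact (Finset.range (m + 1)).isCompact_biUnion fun n _ => (hM n).inter_right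
      ((isOpen_interior.isClosed_compl.inter hC.isClosed).preimage h𝒢.continuous_r)

/-- A compact set on which joining by arrows in `L` is an equivalence relation. -/
structure IsArrowRelCompact (𝒢 : GroupoidOn G X) (L : Set G) (K : Set X) : Prop where
  isCompact : IsCompact K
  symm : ∀ y ∈ K, ∀ z ∈ K, 𝒢.ArrowRel L y z → 𝒢.ArrowRel L z y
  trans : ∀ x ∈ K, ∀ y ∈ K, ∀ z ∈ K, 𝒢.ArrowRel L x y → 𝒢.ArrowRel L y z → 𝒢.ArrowRel L x z

/-- The obstruction is isotropy in `L` far from the units. Where the isotropy has a constant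
pattern, an arrow of `L` between nearby points is close to an isotropy arrow, and dividing by one
leaves an arrow in a small set `V` with `V⁻¹` and `VV` inside `L`. -/
theorem IsContinuous.exists_countable_isArrowRelCompact [LocallyCompactSpace X]
    [SecondCountableTopology X] [T2Space X] [LocallyCompactSpace G] (h𝒢 : 𝒢.IsContinuous)
    {L : Set G} (hXL : range 𝒢.unit ⊆ interior L)
    (hL : ∀ C : Set X, IsCompact C → IsCompact (L ∩ 𝒢.r ⁻¹' C)) (x₀ : X) :
    ∃ N ∈ 𝓝 x₀, ∃ 𝒦 : Set (Set X), 𝒦.Countable ∧ (∀ K ∈ 𝒦, 𝒢.IsArrowRelCompact L K) ∧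
      N ⊆ ⋃₀ 𝒦 := by
  classical
  have hx₀ : 𝒢.unit x₀ ∈ interior L := hXL (mem_range_self x₀)
  obtain ⟨V, hVo, hxV, hVinv, hVmul⟩ : ∃ V : Set G, IsOpen V ∧ 𝒢.unit x₀ ∈ V ∧
      (∀ a ∈ V, 𝒢.inv a ∈ L) ∧
      ∀ a ∈ V, ∀ b ∈ V, ∀ h : 𝒢.s a = 𝒢.r b, 𝒢.mul a b h ∈ L := by
    have hcomp : 𝒢.s (𝒢.unit x₀) = 𝒢.r (𝒢.unit x₀) := by rw [𝒢.s_unit, 𝒢.r_unit]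
    have hmul : 𝒢.mul (𝒢.unit x₀) (𝒢.unit x₀) hcomp = 𝒢.unit x₀ := by
      have h := 𝒢.mul_unit (𝒢.unit x₀)
      simpa only [𝒢.s_unit] using h
    have hinv : 𝒢.inv (𝒢.unit x₀) = 𝒢.unit x₀ := by
      have h1 := 𝒢.unit_mul (𝒢.inv (𝒢.unit x₀))
      have h2 := 𝒢.mul_inv (𝒢.unit x₀)
      simp only [𝒢.r_inv, 𝒢.s_unit, 𝒢.r_unit] at h1 h2
      exact h1.symm.trans h2
    obtain ⟨A, hA, B, hB, hAB⟩ := h𝒢.exists_nhds_mul isOpen_interior hcomp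
      (by rw [hmul]; exact hx₀)
    have hI : 𝒢.inv ⁻¹' interior L ∈ 𝓝 (𝒢.unit x₀) :=
      h𝒢.continuous_inv.continuousAt.preimage_mem_nhds
        (isOpen_interior.mem_nhds (by rw [hinv]; exact hx₀))
    obtain ⟨V, hV, hVo, hxV⟩ := mem_nhds_iff.1 (Filter.inter_mem (Filter.inter_mem hA hB) hI)
    exact ⟨V, hVo, hxV, fun a ha => interior_subset (hV ha).2,
      fun a ha b hb h => interior_subset (hAB a (hV ha).1.1 b (hV hb).1.2 h)⟩
  have hgood : ∀ K : Set X, IsCompact K →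
      (∀ y ∈ K, ∀ z ∈ K, 𝒢.ArrowRel L y z → 𝒢.ArrowRel V y z) → 𝒢.IsArrowRelCompact L K := by
    intro K hK hLV
    refine ⟨hK, fun y hy z hz h => ?_, fun x hx y hy z hz hxy hyz => ?_⟩
    · obtain ⟨γ, hγ, rfl, rfl⟩ := hLV y hy z hz h
      exact ⟨_, hVinv γ hγ, 𝒢.r_inv γ, 𝒢.s_inv γ⟩
    · obtain ⟨a, ha, rfl, rfl⟩ := hLV x hx y hy hxy
      obtain ⟨b, hb, hab, rfl⟩ := hLV _ hy z hz hyz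
      exact ⟨_, hVmul a ha b hb hab.symm, 𝒢.r_mul _ _ _, 𝒢.s_mul _ _ _⟩
  obtain ⟨B, hBn, hBV, hB⟩ := local_compact_nhds
    (h𝒢.continuous_unit.continuousAt.preimage_mem_nhds (hVo.mem_nhds hxV))
  have hdiag : IsClosed {γ | 𝒢.r γ = 𝒢.s γ} := isClosed_eq h𝒢.continuous_r h𝒢.continuous_s
  -- Isotropy in `L` over `B` is covered by finitely many `C γ` with `(C γ)⁻¹ (C γ) ⊆ V`.
  have hC : ∀ γ : G, ∃ C : Set G, γ ∈ L ∩ 𝒢.r ⁻¹' B ∩ {γ | 𝒢.r γ = 𝒢.s γ} →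
      C ∈ 𝓝 γ ∧ IsCompact C ∧
      ∀ a ∈ C, ∀ b ∈ C, ∀ h : 𝒢.s (𝒢.inv a) = 𝒢.r b, 𝒢.mul (𝒢.inv a) b h ∈ V := by
    intro γ
    by_cases hγ : γ ∈ L ∩ 𝒢.r ⁻¹' B ∩ {γ | 𝒢.r γ = 𝒢.s γ}
    · have hu : 𝒢.unit (𝒢.s γ) ∈ V := by
        rw [← show 𝒢.r γ = 𝒢.s γ from hγ.2]
        exact hBV hγ.1.2
      obtain ⟨A, hA, hAV⟩ := h𝒢.exists_nhds_inv_mul hVo hu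
      obtain ⟨C, hC, hCA, hCc⟩ := local_compact_nhds hA
      exact ⟨C, fun _ => ⟨hC, hCc, fun a ha b hb => hAV a (hCA ha) b (hCA hb)⟩⟩
    · exact ⟨∅, fun h => absurd h hγ⟩
  choose C hC using hC
  obtain ⟨t, htP, ht⟩ := ((hL B hB).inter_right hdiag).elim_nhds_subcover
    (fun γ => interior (C γ)) fun γ hγ => interior_mem_nhds.2 (hC γ hγ).1
  let F : G → Set X := fun γ => 𝒢.r '' (C γ ∩ {γ | 𝒢.r γ = 𝒢.s γ})
  have hF : ∀ γ ∈ t, IsClosed (F γ) := fun γ hγ =>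
    (((hC γ (htP γ hγ)).2.1.inter_right hdiag).image h𝒢.continuous_r).isClosed
  -- The pattern `S` records which `C γ` contain isotropy at `y`; finitely many patterns partition
  -- `B`.
  let A : Finset G → Set X := fun S => {y ∈ B | ∀ γ ∈ t, γ ∈ S ↔ y ∈ F γ}
  have hlocal : ∀ S : Finset G, ∀ y : X, ∃ K : Set X, y ∈ A S →
      K ∈ 𝓝[A S] y ∧ 𝒢.IsArrowRelCompact L K := by
    intro S y
    by_cases hy : y ∈ A S
    swap
    · exact ⟨∅, fun h => absurd h hy⟩
    -- `D` has no isotropy at `y`; by compactness it joins no two points near `y`.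
    let D : Set G := (L ∩ 𝒢.r ⁻¹' B) \ ⋃ γ ∈ t.filter (· ∈ S), interior (C γ)
    have hD : IsCompact D := (hL B hB).diff (isOpen_biUnion fun _ _ => isOpen_interior)
    have hD' : IsClosed ((fun γ => (𝒢.r γ, 𝒢.s γ)) '' D) :=
      (hD.image (h𝒢.continuous_r.prodMk h𝒢.continuous_s)).isClosed
    have hyD : (y, y) ∉ (fun γ => (𝒢.r γ, 𝒢.s γ)) '' D := by
      rintro ⟨γ, ⟨hγL, hγ⟩, he⟩
      rw [Prod.mk.injEq] at he
      have hγP : 𝒢.r γ = 𝒢.s γ := he.1.trans he.2.symm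
      obtain ⟨δ, hδ, hγδ⟩ := mem_iUnion₂.1 (ht ⟨hγL, hγP⟩)
      refine hγ (mem_iUnion₂.2 ⟨δ, Finset.mem_filter.2 ⟨hδ, ?_⟩, hγδ⟩)
      exact (hy.2 δ hδ).2 ⟨γ, ⟨interior_subset hγδ, hγP⟩, he.1⟩
    obtain ⟨N₁, hN₁, N₂, hN₂, hN⟩ :=
      mem_nhds_prod_iff.1 (hD'.isOpen_compl.mem_nhds hyD)
    let O : Set X := ⋂ γ ∈ t.filter (· ∉ S), (F γ)ᶜ
    have hO : O ∈ 𝓝 y := by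
      refine (Filter.biInter_finset_mem _).2 fun γ hγ => ?_
      rw [Finset.mem_filter] at hγ
      exact (hF γ hγ.1).isOpen_compl.mem_nhds fun h => hγ.2 ((hy.2 γ hγ.1).2 h)
    obtain ⟨Q, hQ, hQN, hQc⟩ :=
      local_compact_nhds (Filter.inter_mem (Filter.inter_mem hN₁ hN₂) hO)
    let Z : Set X := ⋂ γ ∈ t.filter (· ∈ S), F γ
    have hZ : IsClosed Z := isClosed_biInter fun γ hγ => hF γ (Finset.mem_filter.1 hγ).1
    refine ⟨Q ∩ (B ∩ Z), fun _ => ⟨?_, ?_⟩⟩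
    · refine Filter.inter_mem (mem_nhdsWithin_of_mem_nhds hQ)
        (Filter.mem_of_superset self_mem_nhdsWithin fun z hz => ⟨hz.1, ?_⟩)
      refine mem_iInter₂.2 fun γ hγ => ?_
      rw [Finset.mem_filter] at hγ
      exact (hz.2 γ hγ.1).1 hγ.2
    · refine hgood _ (hQc.inter_right (hB.isClosed.inter hZ)) ?_
      rintro _ hy' _ hz' ⟨γ, hγL, rfl, rfl⟩
      have hγD : γ ∉ D := fun h =>
        hN (mk_mem_prod (hQN hy'.1).1.1 (hQN hz'.1).1.2) (mem_image_of_mem _ h)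
      obtain ⟨δ, hδ, hγδ⟩ : ∃ δ ∈ t.filter (· ∈ S), γ ∈ interior (C δ) := by
        by_contra! hne
        exact hγD ⟨⟨hγL, hy'.2.1⟩, by simpa using hne⟩
      -- Isotropy `ε` in the same `C δ` as `γ`: `ε⁻¹γ` has the endpoints of `γ` and lies in `V`.
      obtain ⟨ε, ⟨hεC, hεP⟩, hεr⟩ := mem_iInter₂.1 hy'.2.2 δ hδ
      have hcomp : 𝒢.s (𝒢.inv ε) = 𝒢.r γ := (𝒢.s_inv ε).trans hεr
      refine ⟨_, (hC δ (htP δ (Finset.mem_filter.1 hδ).1)).2.2 ε hεC γ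
        (interior_subset hγδ) hcomp, ?_, 𝒢.s_mul _ _ _⟩
      rw [𝒢.r_mul, 𝒢.r_inv, ← hεr]
      exact Eq.symm hεP
  choose K hK using hlocal
  choose T hTA hTc hT using fun S : Finset G =>
    countable_cover_nhdsWithin (f := K S) fun y hy => (hK S y hy).1
  refine ⟨B, hBn, ⋃ S ∈ t.powerset, K S '' T S, ?_, ?_, ?_⟩
  · exact t.powerset.countable_toSet.biUnion fun S _ => (hTc S).image _
  · simp only [mem_iUnion]
    rintro _ ⟨S, -, y, hy, rfl⟩
    exact (hK S y (hTA S hy)).2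
  · intro y hy
    have hyA : y ∈ A (t.filter fun γ => y ∈ F γ) :=
      ⟨hy, fun γ hγ => by simp only [Finset.mem_filter, hγ, true_and]⟩
    obtain ⟨z, hz, hyz⟩ := mem_iUnion₂.1 (hT _ hyA)
    exact ⟨_, mem_iUnion₂.2 ⟨_, Finset.mem_powerset.2 (Finset.filter_subset _ _),
      mem_image_of_mem _ hz⟩, hyz⟩

end GroupoidOn

/-! ### Borel transversals -/

/-- Sum `3⁻ⁿ` times the indicators of a countable base: the terms are nonnegative and lower
semicontinuous, and the ratio `1/3 < 1/2` makes the sum determine every indicator. -/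
theorem LowerSemicontinuous.exists_injective_real (X : Type*) [TopologicalSpace X]
    [SecondCountableTopology X] [T0Space X] :
    ∃ g : X → ℝ, LowerSemicontinuous g ∧ Function.Injective g := by
  classical
  rcases isEmpty_or_nonempty X with hX | hX
  · exact ⟨fun _ => 0, lowerSemicontinuous_const, fun x => isEmptyElim x⟩
  obtain ⟨b, hb, hbB⟩ : ∃ b : ℕ → Set X, (∀ n, IsOpen (b n)) ∧ IsTopologicalBasis (range b) := by
    obtain ⟨b, hb⟩ := (countable_countableBasis X).exists_eq_range
      (nonempty_iff_ne_empty.2 fun h => by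
        have := (isBasis_countableBasis X).sUnion_eq
        rw [h, sUnion_empty] at this
        exact empty_ne_univ this)
    refine ⟨b, fun n => isOpen_of_mem_countableBasis (hb ▸ mem_range_self n),
      hb ▸ isBasis_countableBasis X⟩
  let e : X → ℕ → Bool := fun x n => decide (x ∈ b n)
  have hs : ∀ x, Summable (Cardinal.cantorFunctionAux (1 / 3) (e x)) := fun x =>
    Cardinal.summable_cantor_function _ (by norm_num) (by norm_num)
  have hnn : ∀ x n, 0 ≤ Cardinal.cantorFunctionAux (1 / 3) (e x) n := fun x n =>
    Cardinal.cantorFunctionAux_nonneg (by norm_num)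
  refine ⟨fun x => Cardinal.cantorFunction (1 / 3) (e x), ?_, ?_⟩
  · have hterm : ∀ n, LowerSemicontinuous fun x => Cardinal.cantorFunctionAux (1 / 3) (e x) n := by
      intro n
      have h := (hb n).lowerSemicontinuous_indicator (y := (1 / 3 : ℝ) ^ n) (by positivity)
      convert h using 2 with x
      by_cases hx : x ∈ b n <;> simp [Cardinal.cantorFunctionAux, e, hx]
    intro x q hq
    obtain ⟨s, hsq⟩ := ((hs x).hasSum.eventually_const_lt hq).exists
    filter_upwards [lowerSemicontinuous_sum (fun n _ => hterm n) x q hsq] with z hz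
    exact hz.trans_le ((hs z).sum_le_tsum s fun n _ => hnn z n)
  · refine (Cardinal.cantorFunction_injective (by norm_num) (by norm_num)).comp ?_
    intro x y hxy
    refine hbB.eq_iff.2 ?_
    rintro _ ⟨n, rfl⟩
    simpa [e] using congrFun hxy n

namespace GroupoidOn

variable {G X : Type*} {𝒢 : GroupoidOn G X} [TopologicalSpace G] [TopologicalSpace X]

theorem IsContinuous.isCompact_arrowRel_image (h𝒢 : 𝒢.IsContinuous) [T2Space X] {L : Set G}
    (hL : ∀ C : Set X, IsCompact C → IsCompact (L ∩ 𝒢.r ⁻¹' C)) {C : Set X} (hC : IsCompact C) :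
    IsCompact {z | ∃ y ∈ C, 𝒢.ArrowRel L y z} := by
  convert (hL C hC).image h𝒢.continuous_s using 1
  ext z
  constructor
  · rintro ⟨_, hy, γ, hγ, rfl, rfl⟩
    exact ⟨γ, ⟨hγ, hy⟩, rfl⟩
  · rintro ⟨γ, ⟨hγ, hy⟩, rfl⟩
    exact ⟨_, hy, γ, hγ, rfl, rfl⟩

/-- A Borel set meeting every class of the equivalence relation on `K` in exactly one point. -/
theorem IsArrowRelCompact.exists_transversal [T2Space X] [SecondCountableTopology X]
    [MeasurableSpace X] [BorelSpace X]
    (h𝒢 : 𝒢.IsContinuous) {L : Set G} (hXL : range 𝒢.unit ⊆ L)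
    (hL : ∀ C : Set X, IsCompact C → IsCompact (L ∩ 𝒢.r ⁻¹' C)) {K : Set X}
    (hK : 𝒢.IsArrowRelCompact L K) :
    ∃ T ⊆ K, MeasurableSet T ∧ (∀ y ∈ K, ∃ z ∈ T, 𝒢.ArrowRel L y z) ∧
      ∀ y ∈ T, ∀ z ∈ T, 𝒢.ArrowRel L y z → y = z := by
  obtain ⟨g, hg, hginj⟩ := LowerSemicontinuous.exists_injective_real X
  -- The minimizers of `g` on their classes: a point is removed when a rational separates its value
  -- from a smaller one in its class, which exhibits a Borel set.
  refine ⟨K \ ⋃ q : ℚ, {y | (q : ℝ) < g y} ∩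
    {z | ∃ y ∈ K ∩ {y | g y ≤ q}, 𝒢.ArrowRel L y z}, sdiff_subset, ?_, ?_, ?_⟩
  · refine hK.isCompact.measurableSet.diff (MeasurableSet.iUnion fun q => ?_)
    exact (hg.isOpen_preimage q).measurableSet.inter (h𝒢.isCompact_arrowRel_image hL
      (hK.isCompact.inter_right (hg.isClosed_preimage q))).measurableSet
  · intro y hy
    have hc : IsCompact (K ∩ {z | ∃ y' ∈ ({y} : Set X), 𝒢.ArrowRel L y' z}) :=
      hK.isCompact.inter_right (h𝒢.isCompact_arrowRel_image hL isCompact_singleton).isClosed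
    have hne : (K ∩ {z | ∃ y' ∈ ({y} : Set X), 𝒢.ArrowRel L y' z}).Nonempty :=
      ⟨y, hy, y, rfl, 𝒢.unit y, hXL (mem_range_self y), 𝒢.r_unit y, 𝒢.s_unit y⟩
    obtain ⟨z, ⟨hzK, y', rfl, hyz⟩, hz⟩ := (hg.lowerSemicontinuousOn _).exists_isMinOn hne hc
    refine ⟨z, ⟨hzK, ?_⟩, hyz⟩
    simp only [mem_iUnion, not_exists]
    rintro q ⟨hqz, w, ⟨hwK, hwq⟩, hwz⟩
    have hyw := hK.trans _ hy _ hzK _ hwK hyz (hK.symm _ hwK _ hzK hwz)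
    have hzw : g z ≤ g w := hz ⟨hwK, _, rfl, hyw⟩
    exact (hwq.trans_lt hqz).not_ge hzw
  · have key : ∀ y ∈ K, ∀ z ∈ K \ ⋃ q : ℚ, {y | (q : ℝ) < g y} ∩
        {z | ∃ y ∈ K ∩ {y | g y ≤ q}, 𝒢.ArrowRel L y z}, 𝒢.ArrowRel L y z → g z ≤ g y := by
      intro y hy z hz hyz
      by_contra! hlt
      obtain ⟨q, hyq, hqz⟩ := exists_rat_btwn hlt
      exact hz.2 (mem_iUnion.2 ⟨q, hqz, y, ⟨hy, hyq.le⟩, hyz⟩)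
    intro y hy z hz hyz
    exact hginj (le_antisymm (key z hz.1 y hy (hK.symm _ hy.1 _ hz.1 hyz)) (key y hy.1 z hz hyz))

/-! ### Assembling the section -/

theorem IsContinuous.measurableSet_saturation [T2Space X] [MeasurableSpace X] [BorelSpace X]
    [SigmaCompactSpace G] (h𝒢 : 𝒢.IsContinuous) {K : Set X} (hK : IsCompact K) :
    MeasurableSet {z | ∃ y ∈ K, z ∈ 𝒢.orbit y} := by
  have heq : {z | ∃ y ∈ K, z ∈ 𝒢.orbit y} =
      ⋃ n, 𝒢.s '' (compactCovering G n ∩ 𝒢.r ⁻¹' K) := by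
    ext z
    simp only [mem_iUnion]
    constructor
    · rintro ⟨_, hy, γ, rfl, rfl⟩
      obtain ⟨n, hn⟩ := exists_mem_compactCovering γ
      exact ⟨n, γ, ⟨hn, hy⟩, rfl⟩
    · rintro ⟨n, γ, ⟨-, hy⟩, rfl⟩
      exact ⟨_, hy, γ, rfl, rfl⟩
  rw [heq]
  exact MeasurableSet.iUnion fun n => (((isCompact_compactCovering G n).inter_right
    (hK.isClosed.preimage h𝒢.continuous_r)).image h𝒢.continuous_s).measurableSet

theorem IsContinuous.exists_isCompleteLacunarySection [SecondCountableTopology X]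
    [LocallyCompactSpace X] [T2Space X] [SecondCountableTopology G] [LocallyCompactSpace G]
    (h𝒢 : 𝒢.IsContinuous) : ∃ Y : Set X, 𝒢.IsCompleteLacunarySection Y := by
  let _ : MeasurableSpace X := borel X
  have : BorelSpace X := ⟨rfl⟩
  obtain ⟨L, hXL, hL⟩ := h𝒢.exists_proper_nhds_unit
  choose N hN 𝒦 h𝒦c h𝒦 hN𝒦 using h𝒢.exists_countable_isArrowRelCompact hXL hL
  obtain ⟨t, ht, htu⟩ := TopologicalSpace.countable_cover_nhds hN
  -- Adding `∅` keeps the family nonempty, so that it can be enumerated.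
  obtain ⟨K, hKeq⟩ := ((ht.biUnion fun x _ => h𝒦c x).insert ∅).exists_eq_range
    (insert_nonempty _ _)
  have hK : ∀ n, 𝒢.IsArrowRelCompact L (K n) := by
    intro n
    have hn : K n ∈ insert ∅ (⋃ x ∈ t, 𝒦 x) := hKeq ▸ mem_range_self n
    rcases hn with hn | hn
    · rw [hn]
      exact ⟨isCompact_empty, by simp, by simp⟩
    · obtain ⟨x, -, hx⟩ := mem_iUnion₂.1 hn
      exact h𝒦 x _ hx
  have hcover : ∀ x, ∃ n, x ∈ K n := by
    intro x
    obtain ⟨y, hy, hxy⟩ := mem_iUnion₂.1 (htu ▸ mem_univ x)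
    obtain ⟨Q, hQ, hxQ⟩ := hN𝒦 y hxy
    obtain ⟨n, rfl⟩ : Q ∈ range K := hKeq ▸ Or.inr (mem_iUnion₂.2 ⟨y, hy, hQ⟩)
    exact ⟨n, hxQ⟩
  choose T hTK hTm hTmeet hTinj using fun n =>
    (hK n).exists_transversal h𝒢 (hXL.trans interior_subset) hL
  -- Each orbit contributes points only from the first `K n` it meets.
  refine ⟨⋃ n, T n \ ⋃ j < n, {z | ∃ y ∈ K j, z ∈ 𝒢.orbit y}, ?_, ?_, interior L,
    isOpen_interior, hXL, ?_⟩
  · exact MeasurableSet.iUnion fun n => (hTm n).diff (MeasurableSet.iUnion fun j =>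
      MeasurableSet.iUnion fun _ => h𝒢.measurableSet_saturation (hK j).isCompact)
  · intro x
    classical
    have hex : ∃ n, ∃ y ∈ K n, y ∈ 𝒢.orbit x := by
      obtain ⟨n, hn⟩ := hcover x
      exact ⟨n, x, hn, mem_orbit_self x⟩
    obtain ⟨y, hyK, hy⟩ := Nat.find_spec hex
    obtain ⟨z, hzT, hyz⟩ := hTmeet _ y hyK
    have hz := mem_orbit_trans hy hyz.mem_orbit
    refine ⟨z, hz, mem_iUnion.2 ⟨Nat.find hex, hzT, ?_⟩⟩
    simp only [mem_iUnion, not_exists]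
    rintro j hj ⟨w, hwK, hwz⟩
    exact Nat.find_min hex hj ⟨w, hwK, mem_orbit_trans hz (mem_orbit_symm hwz)⟩
  · intro y hyY
    ext z
    simp only [mem_inter_iff, mem_bracket_singleton, mem_singleton_iff]
    constructor
    · rintro ⟨⟨γ, hγ, hr, hs⟩, hzY⟩
      have hyz : 𝒢.ArrowRel L y z := ⟨γ, interior_subset hγ, hr, hs⟩
      obtain ⟨m, hym, hy⟩ := mem_iUnion.1 hyY
      obtain ⟨n, hzn, hz⟩ := mem_iUnion.1 hzY
      rcases lt_trichotomy m n with h | rfl | h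
      · exact (hz (mem_biUnion h ⟨y, hTK m hym, hyz.mem_orbit⟩)).elim
      · exact (hTinj m y hym z hzn hyz).symm
      · exact (hy (mem_biUnion h ⟨z, hTK n hzn, mem_orbit_symm hyz.mem_orbit⟩)).elim
    · rintro rfl
      exact ⟨⟨𝒢.unit z, hXL (mem_range_self z), 𝒢.r_unit z, 𝒢.s_unit z⟩, hyY⟩

end GroupoidOn

theorem theoremA {G X : Type*} [TopologicalSpace G] [TopologicalSpace X]
    [SecondCountableTopology X] [LocallyCompactSpace X] [T2Space X]
    [SecondCountableTopology G] [LocallyCompactSpace G] (hG : IsLocallyHausdorff G)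
    (𝒢 : GroupoidOn G X) (h𝒢 : 𝒢.IsContinuous) :
    (∃ Y : Set X, 𝒢.IsCompleteLacunarySection Y) ∧
      ∀ Y : Set X, 𝒢.IsCompleteLacunarySection Y → ∀ x : X, (𝒢.orbit x ∩ Y).Countable := by
  exact ⟨h𝒢.exists_isCompleteLacunarySection, fun _ hY x => hY.countable_orbit_inter h𝒢 x⟩
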